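/- Let $d,k,N,m$ be integers with $1\le m\le N$, let $\varphi_1,\dots,\varphi_k:\mathbb R^d\to\mathbb C$ be continuous, and assume that for all $b_1,\dots,b_k>0$ there is $\xi\in\mathbb R^d$ with $|\varphi_i(\xi)|=b_i$, $i=1,\dots,k$. For $\alpha\in\mathbb R_+^k$, $\mathbb R_+=[0,\infty)$, put $\varphi^\alpha=\varphi_1^{\alpha_1}\cdots\varphi_k^{\alpha_k}$ (principal branches, $0^0=1$). Let $\alpha^1,\dots,\alpha^N\in\mathbb R_+^k$, $\delta_1,\dots,\delta_N>0$ and $\alpha^0\in\operatorname{co}\{\alpha^1,\dots,\alpha^N\}$. Let $F$ be the Fourier transform on $L_2(\mathbb R^d)$, normalized by $Fx(\xi)=\int x(t)e^{-2\pi i\langle t,\xi\rangle}\,dt$, let $$\mathcal W=\{x\in L_2(\mathbb R^d):\varphi^{\alpha^j}Fx\in L_2(\mathbb R^d),\ j=1,\dots,N\},\qquad \Lambda_jx=F^{-1}(\varphi^{\alpha^j}Fx),\quad j=0,1,\dots,N$$ (for $x\in\mathcal W$ also $\varphi^{\alpha^0}Fx\in L_2(\mathbb R^d)$), and let $W=\{x\in\mathcal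 W:\|\Lambda_jx\|\le\delta_j,\ j=m+1,\dots,N\}$, where $\|\cdot\|$ is the norm of $L_2(\mathbb R^d)$. The error of a method, i.e. of an arbitrary map $\Phi:L_2(\mathbb R^d)^m\to L_2(\mathbb R^d)$, is $$e(\Phi)=\sup\{\|\Lambda_0x-\Phi(y)\|:\ x\in W,\ y\in L_2(\mathbb R^d)^m,\ \|\Lambda_jx-y_j\|\le\delta_j,\ j=1,\dots,m\};$$ $E=\inf_\Phi e(\Phi)$ is the error of optimal recovery, and $\Phi$ is optimal if $e(\Phi)=E$. Let $Q=\operatorname{co}\{(\alpha^j,\ln(1/\delta_j)):j=1,\dots,N\}\subset\mathbb R^{k+1}$ and $S(\alpha)=\max\{z\in\mathbb R:(\alpha,z)\in Q\}$ ($=-\infty$ if there is no such $z$). **Theorem 2.** The maximum defining $S(\alpha^0)$ is attained, and $E=e^{-S(\alpha^0)}$. There is a support hyperplane $z=\langle\alpha,\widehat\eta\rangle+\widehat a$ to the graph of $S$ at $\alpha^0$, that is, $S(\alpha^0)=\langle\alpha^0,\widehat\eta\rangle+\widehat a$ and $S(\alpha)\le\langle\alpha,\widehat\eta\rangle+\widehat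 a$ for all $\alpha\in\mathbb R^k$. Fix any such hyperplane. Then there are a set $J\subset\{1,\dots,N\}$ with $|J|\le k+1$ and numbers $\theta_j>0$, $j\in J$, such that $$(\ast)\qquad \ln(1/\delta_j)=\langle\alpha^j,\widehat\eta\rangle+\widehat a\ \ (j\in J),\qquad \sum_{j\in J}\theta_j=1,\qquad \alpha^0=\sum_{j\in J}\theta_j\alpha^j,$$ and such that the points $\alpha^j$, $j\in J$, are affinely independent. For any $J$ and $\theta_j>0$, $j\in J$, that satisfy $(\ast)$, put $M=J\cap\{1,\dots,m\}$. Then: 1. There are measurable functions $a_j:\mathbb R^d\to\mathbb C$, $j\in J$, such that for almost all $\xi\in\mathbb R^d$ $$\sum_{j\in J}\varphi^{\alpha^j}(\xi)a_j(\xi)=\varphi^{\alpha^0}(\xi),\qquad \sum_{j\in J}\frac{\delta_j^2|a_j(\xi)|^2}{\theta_j}\le e^{-2S(\alpha^0)}.$$ If $M\ne\emptyset$, then for all such functions the method $\Phi(y)=F^{-1}\big(\sum_{j\in M}a_jFy_j\big)$ is well defined and optimal. If $M=\emptyset$, then the method $\Phi(y)=0$ is optimal. 2. For all $x\in\mathcal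 W$ $$\|\Lambda_0x\|\le\prod_{j\in J}\|\Lambda_jx\|^{\theta_j}.$$ The constant $1$ on the right-hand side cannot be replaced by a smaller one, and $\sup\{\|\Lambda_0x\|:x\in\mathcal W,\ \|\Lambda_jx\|\le\delta_j,\ j=1,\dots,N\}=\prod_{j\in J}\delta_j^{\theta_j}$. If the points $\alpha^j$, $j\in J$, are affinely independent, then the inequality is exact in the sense that there is no $x_0\in\mathcal W$ with $$\sup\{\|\Lambda_0x\|:x\in\mathcal W,\ \|\Lambda_jx\|\le\|\Lambda_jx_0\|,\ j\in J\}<\prod_{j\in J}\|\Lambda_jx_0\|^{\theta_j}.$$ -/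

import Mathlib

namespace OptimalRecovery

open MeasureTheory
open scoped ENNReal FourierTransform

noncomputable section

/-! ### Optimal recovery and exact inequalities, general setting -/

/-- The error of a recovery method `Φ`: the supremum of `‖Λ₀ x - Φ y‖` over all `x ∈ W` and all data
`y = (y_j)` with `‖Λ_j x - y_j‖ ≤ δ_j`. -/
def methodError {X Y Z ι : Type*} [NormedAddCommGroup Y] [NormedAddCommGroup Z]
    (Λ₀ : X → Z) (W : Set X) (Λ : ι → X → Y) (δ : ι → ℝ) (Φ : (ι → Y) → Z) : ℝ≥0∞ :=
  ⨆ (x : X) (_ : x ∈ W) (y : ι → Y) (_ : ∀ j, ‖Λ j x - y j‖ ≤ δ j), ‖Λ₀ x - Φ y‖ₑ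

/-- The error of optimal recovery: the infimum of the errors of all methods (arbitrary maps). -/
def optimalError {X Y Z ι : Type*} [NormedAddCommGroup Y] [NormedAddCommGroup Z]
    (Λ₀ : X → Z) (W : Set X) (Λ : ι → X → Y) (δ : ι → ℝ) : ℝ≥0∞ :=
  ⨅ Φ : (ι → Y) → Z, methodError Λ₀ W Λ δ Φ

/-- A method is optimal if its error is minimal. -/
def IsOptimalMethod {X Y Z ι : Type*} [NormedAddCommGroup Y] [NormedAddCommGroup Z]
    (Λ₀ : X → Z) (W : Set X) (Λ : ι → X → Y) (δ : ι → ℝ) (Φ : (ι → Y) → Z) : Prop :=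
  methodError Λ₀ W Λ δ Φ = optimalError Λ₀ W Λ δ

/-- The inequality `‖Λ₀ x‖ ≤ κ ((‖Λ_j x‖)_j)` on `X₀` is exact: it holds for all `x ∈ X₀`, and there
is no `x₀ ∈ X₀` for which the supremum of `‖Λ₀ x‖` over the `x ∈ X₀` with `‖Λ_j x‖ ≤ ‖Λ_j x₀‖` for
all `j` is smaller than `κ ((‖Λ_j x₀‖)_j)`. -/
def IsExactInequality {X Y Z ι : Type*} [NormedAddCommGroup Y] [NormedAddCommGroup Z]
    (X₀ : Set X) (Λ₀ : X → Z) (Λ : ι → X → Y) (κ : (ι → ℝ) → ℝ) : Prop :=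
  (∀ x ∈ X₀, ‖Λ₀ x‖ ≤ κ (fun j => ‖Λ j x‖)) ∧
  ¬ ∃ x₀ ∈ X₀,
    (⨆ (x : X) (_ : x ∈ X₀) (_ : ∀ j, ‖Λ j x‖ ≤ ‖Λ j x₀‖), ‖Λ₀ x‖ₑ) <
      ENNReal.ofReal (κ (fun j => ‖Λ j x₀‖))

/-! ### Fourier multipliers on `L₂(ℝᵈ)` -/

/-- `ℝᵈ`. -/
abbrev Rd (d : ℕ) : Type := EuclideanSpace ℝ (Fin d)

/-- `L₂(ℝᵈ)`, complex valued. -/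
abbrev L2 (d : ℕ) : Type := Lp (α := Rd d) ℂ 2

/-- `φ^α = φ₁^{α₁} ⋯ φ_k^{α_k}`, with the principal branch of the powers. -/
def powSymbol {d k : ℕ} (φ : Fin k → Rd d → ℂ) (α : Fin k → ℝ) (ξ : Rd d) : ℂ :=
  ∏ i, φ i ξ ^ ((α i : ℝ) : ℂ)

open Classical in
/-- The inverse Fourier transform of a function in `L₂(ℝᵈ)` (and `0` if `f` is not in `L₂`). -/
def invFourier {d : ℕ} (f : Rd d → ℂ) : L2 d :=
  if h : MemLp f 2 (volume : Measure (Rd d)) then 𝓕⁻ (h.toLp f) else 0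

/-- The operator `x ↦ F⁻¹(φ^α F x)`. -/
def multOp {d k : ℕ} (φ : Fin k → Rd d → ℂ) (α : Fin k → ℝ) (x : L2 d) : L2 d :=
  invFourier (fun ξ => powSymbol φ α ξ * (𝓕 x : L2 d) ξ)

/-- The space of `x ∈ L₂(ℝᵈ)` with `φ^{α^j} F x ∈ L₂(ℝᵈ)` for all `j`. -/
def smoothSpace {d k N : ℕ} (φ : Fin k → Rd d → ℂ) (α : Fin N → Fin k → ℝ) : Set (L2 d) :=
  {x | ∀ j, MemLp (fun ξ => powSymbol φ (α j) ξ * (𝓕 x : L2 d) ξ) 2 (volume : Measure (Rd d))}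

/-- The class of `x` in the above space with `‖Λ_j x‖ ≤ δ_j` for the last `N - m` indices `j`. The
indices `1, …, N` are represented by `0, …, N - 1`. -/
def smoothClass {d k N : ℕ} (m : ℕ) (φ : Fin k → Rd d → ℂ) (α : Fin N → Fin k → ℝ)
    (δ : Fin N → ℝ) : Set (L2 d) :=
  {x | x ∈ smoothSpace φ α ∧ ∀ j : Fin N, m ≤ (j : ℕ) → ‖multOp φ (α j) x‖ ≤ δ j}

/-- The method `y ↦ F⁻¹(∑_{j ∈ M} a_j F y_j)`. -/
def multMethod {d m : ℕ} (M : Finset (Fin m)) (a : Fin m → Rd d → ℂ) (y : Fin m → L2 d) : L2 d :=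
  invFourier (fun ξ => ∑ j ∈ M, a j ξ * (𝓕 (y j) : L2 d) ξ)

/-! ### The function `S` -/

/-- `Q`, the convex hull of the points `(α^j, ln (1/δ_j))`. -/
def hullQ {k N : ℕ} (α : Fin N → Fin k → ℝ) (δ : Fin N → ℝ) : Set ((Fin k → ℝ) × ℝ) :=
  convexHull ℝ (Set.range fun j => (α j, Real.log (1 / δ j)))

/-- `S(β) = max {z : (β, z) ∈ Q}`, equal to `-∞` if there is no such `z`. -/
def funS {k N : ℕ} (α : Fin N → Fin k → ℝ) (δ : Fin N → ℝ) (β : Fin k → ℝ) : EReal :=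
  sSup ((fun z : ℝ => (z : EReal)) '' {z : ℝ | (β, z) ∈ hullQ α δ})

/-- `z = ⟨β, η⟩ + c` is a support hyperplane to the graph of `S` at `α₀`. -/
def IsSupportHyperplane {k N : ℕ} (α : Fin N → Fin k → ℝ) (δ : Fin N → ℝ) (α₀ : Fin k → ℝ)
    (η : Fin k → ℝ) (c : ℝ) : Prop :=
  funS α δ α₀ = ((α₀ ⬝ᵥ η + c : ℝ) : EReal) ∧
  ∀ β : Fin k → ℝ, funS α δ β ≤ ((β ⬝ᵥ η + c : ℝ) : EReal)

/-- The points `(α^j, ln (1/δ_j))`, `j ∈ J`, lie in the hyperplane `z = ⟨β, η⟩ + c`, and `α₀` is the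
convex combination of the `α^j`, `j ∈ J`, with the positive weights `θ_j`. -/
structure IsRepresentation {k N : ℕ} (α : Fin N → Fin k → ℝ) (δ : Fin N → ℝ) (α₀ : Fin k → ℝ)
    (η : Fin k → ℝ) (c : ℝ) (J : Finset (Fin N)) (θ : Fin N → ℝ) : Prop where
  mem_hyperplane : ∀ j ∈ J, Real.log (1 / δ j) = α j ⬝ᵥ η + c
  pos : ∀ j ∈ J, 0 < θ j
  sum_eq_one : ∑ j ∈ J, θ j = 1
  sum_eq : ∑ j ∈ J, θ j • α j = α₀

/-- `M`, the set of those of the first `m` indices that belong to `J`. -/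
def observed {m N : ℕ} (hmN : m ≤ N) (J : Finset (Fin N)) : Finset (Fin m) :=
  Finset.univ.filter fun j => Fin.castLE hmN j ∈ J

/-- The conditions on the functions `a_j`, `j ∈ J`, where `s = S(α₀)`: they are measurable, and for
almost all `ξ` one has `∑_{j ∈ J} φ^{α^j}(ξ) a_j(ξ) = φ^{α₀}(ξ)` and
`∑_{j ∈ J} δ_j² |a_j(ξ)|² / θ_j ≤ e^{-2s}`. -/
structure IsAdmissible {d k N : ℕ} (φ : Fin k → Rd d → ℂ) (α : Fin N → Fin k → ℝ) (δ : Fin N → ℝ)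
    (α₀ : Fin k → ℝ) (J : Finset (Fin N)) (θ : Fin N → ℝ) (s : ℝ) (a : Fin N → Rd d → ℂ) :
    Prop where
  measurable : ∀ j ∈ J, AEStronglyMeasurable (a j) (volume : Measure (Rd d))
  sum_eq : ∀ᵐ ξ : Rd d, ∑ j ∈ J, powSymbol φ (α j) ξ * a j ξ = powSymbol φ α₀ ξ
  sum_le : ∀ᵐ ξ : Rd d, ∑ j ∈ J, δ j ^ 2 * ‖a j ξ‖ ^ 2 / θ j ≤ Real.exp (-2 * s)

end

end OptimalRecovery

namespace OptimalRecovery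

open MeasureTheory
open scoped ENNReal FourierTransform

/-! ### Farkas' lemma -/

/-- **Farkas' lemma** for finitely many linear functionals on a real vector space. -/
theorem exists_nonneg_sum_eq_of_forall_nonpos {V ι : Type*} [AddCommGroup V] [Module ℝ V]
    (s : Finset ι) (f : ι → V →ₗ[ℝ] ℝ) (g : V →ₗ[ℝ] ℝ)
    (h : ∀ x, (∀ i ∈ s, f i x ≤ 0) → g x ≤ 0) :
    ∃ w : ι → ℝ, (∀ i, 0 ≤ w i) ∧ g = ∑ i ∈ s, w i • f i := by
  classical
  induction s using Finset.induction_on generalizing f g with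
  | empty =>
    refine ⟨0, fun _ => le_rfl, LinearMap.ext fun x => ?_⟩
    have h₁ := h x (by simp)
    have h₂ := h (-x) (by simp)
    simp only [map_neg] at h₂
    simp only [Finset.sum_empty, LinearMap.zero_apply]
    linarith
  | insert i₀ s hi₀ ih =>
    by_cases hs : ∀ x, (∀ i ∈ s, f i x ≤ 0) → g x ≤ 0
    · obtain ⟨w, hw, rfl⟩ := ih f g hs
      refine ⟨Function.update w i₀ 0, fun i => ?_, ?_⟩
      · rcases eq_or_ne i i₀ with rfl | hi
        · simp
        · simpa [hi] using hw i
      · rw [Finset.sum_insert hi₀]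
        simp only [Function.update_self, zero_smul, zero_add]
        refine Finset.sum_congr rfl fun i hi => ?_
        rw [Function.update_of_ne (ne_of_mem_of_not_mem hi hi₀)]
    · push Not at hs
      obtain ⟨x₁, hx₁, hgx₁⟩ := hs
      have hpos : 0 < f i₀ x₁ := by
        by_contra hneg
        refine absurd (h x₁ fun i hi => ?_) (not_le.2 hgx₁)
        rcases Finset.mem_insert.1 hi with rfl | hi
        · exact not_lt.1 hneg
        · exact hx₁ i hi
      set x₀ : V := (f i₀ x₁)⁻¹ • x₁ with hx₀
      have hf₀ : f i₀ x₀ = 1 := by simp [hx₀, hpos.ne']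
      have hfs : ∀ i ∈ s, f i x₀ ≤ 0 := fun i hi => by
        simp only [hx₀, map_smul, smul_eq_mul]
        exact mul_nonpos_of_nonneg_of_nonpos (inv_nonneg.2 hpos.le) (hx₁ i hi)
      have hg₀ : 0 ≤ g x₀ := by
        simp only [hx₀, map_smul, smul_eq_mul]
        positivity
      obtain ⟨w, hw, hgw⟩ := ih (fun i => f i - f i x₀ • f i₀) (g - g x₀ • f i₀) fun x hx => by
        have := h (x - f i₀ x • x₀) fun i hi => by
          rcases Finset.mem_insert.1 hi with rfl | hi
          · simp [hf₀]
          · have := hx i hi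
            simp only [LinearMap.sub_apply, LinearMap.smul_apply, smul_eq_mul] at this
            simp only [map_sub, map_smul, smul_eq_mul]
            linarith
        simp only [map_sub, map_smul, smul_eq_mul] at this
        simp only [LinearMap.sub_apply, LinearMap.smul_apply, smul_eq_mul]
        linarith
      refine ⟨Function.update w i₀ (g x₀ - ∑ i ∈ s, w i * f i x₀), fun i => ?_, ?_⟩
      · rcases eq_or_ne i i₀ with rfl | hi
        · simp only [Function.update_self]
          have : ∑ j ∈ s, w j * f j x₀ ≤ 0 := Finset.sum_nonpos fun j hj =>
            mul_nonpos_of_nonneg_of_nonpos (hw j) (hfs j hj)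
          linarith
        · simpa [hi] using hw i
      · rw [Finset.sum_insert hi₀]
        have hsum : ∑ i ∈ s, Function.update w i₀ (g x₀ - ∑ i ∈ s, w i * f i x₀) i • f i
            = ∑ i ∈ s, w i • f i := Finset.sum_congr rfl fun i hi => by
          rw [Function.update_of_ne (ne_of_mem_of_not_mem hi hi₀)]
        rw [hsum, Function.update_self]
        have hg : g = g x₀ • f i₀ + ∑ i ∈ s, w i • (f i - f i x₀ • f i₀) := by
          rw [← hgw]; abel
        refine LinearMap.ext fun x => ?_
        have := LinearMap.congr_fun hg x
        simp only [LinearMap.add_apply, LinearMap.smul_apply, smul_eq_mul, LinearMap.sum_apply,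
          LinearMap.sub_apply, mul_sub, Finset.sum_sub_distrib] at this ⊢
        rw [this, sub_mul, Finset.sum_mul]
        simp only [mul_assoc]
        ring

/-- An affinely independent family of points admits an affine function with prescribed values. -/
theorem exists_dotProduct_add_eq_of_affineIndependent {k : ℕ} {ι : Type*} [Nonempty ι]
    {p : ι → Fin k → ℝ} (hp : AffineIndependent ℝ p) (w : ι → ℝ) :
    ∃ (η : Fin k → ℝ) (c : ℝ), ∀ i, w i = p i ⬝ᵥ η + c := by
  obtain ⟨i₀⟩ := ‹Nonempty ι›
  have hli := (affineIndependent_iff_linearIndependent_vsub ℝ p i₀).1 hp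
  obtain ⟨g, hg⟩ := LinearMap.exists_leftInverse_of_injective _ (LinearMap.ker_eq_bot.2 hli)
  let f : (Fin k → ℝ) →ₗ[ℝ] ℝ :=
    (Finsupp.linearCombination ℝ fun i : {i // i ≠ i₀} => w i - w i₀) ∘ₗ g
  have hf : ∀ i : {i // i ≠ i₀}, f (p i - p i₀) = w i - w i₀ := fun i => by
    have := LinearMap.congr_fun hg (Finsupp.single i 1)
    simp only [LinearMap.comp_apply, Finsupp.linearCombination_single, one_smul, LinearMap.id_apply,
      vsub_eq_sub] at this
    simp [f, this]
  have hη : ∀ v : Fin k → ℝ, f v = v ⬝ᵥ fun i => f (Pi.single i 1) := fun v => by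
    conv_lhs => rw [← Finset.univ_sum_single v, map_sum]
    refine Finset.sum_congr rfl fun i _ => ?_
    rw [← smul_eq_mul, ← map_smul]
    congr 1
    ext j
    simp [Pi.single_apply]
  refine ⟨fun i => f (Pi.single i 1), w i₀ - f (p i₀), fun i => ?_⟩
  rw [← hη]
  rcases eq_or_ne i i₀ with rfl | hi
  · ring
  · have := hf ⟨i, hi⟩
    rw [map_sub] at this
    linarith

/-! ### The function `S` -/

section FunS

variable {k N : ℕ} {α : Fin N → Fin k → ℝ} {δ : Fin N → ℝ} {α₀ η : Fin k → ℝ} {c : ℝ}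

theorem isGreatest_toReal_funS (hα₀ : α₀ ∈ convexHull ℝ (Set.range α)) :
    IsGreatest {z : ℝ | (α₀, z) ∈ hullQ α δ} (funS α δ α₀).toReal ∧
      funS α δ α₀ = ((funS α δ α₀).toReal : EReal) := by
  have hcomp : IsCompact (hullQ α δ) := (Set.finite_range _).isCompact_convexHull ℝ
  have himg : {z : ℝ | (α₀, z) ∈ hullQ α δ} = Prod.snd '' (hullQ α δ ∩ Prod.fst ⁻¹' {α₀}) := by
    ext z
    simp
  have hT : IsCompact {z : ℝ | (α₀, z) ∈ hullQ α δ} := by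
    rw [himg]
    exact (hcomp.inter_right (isClosed_singleton.preimage continuous_fst)).image continuous_snd
  have hne : {z : ℝ | (α₀, z) ∈ hullQ α δ}.Nonempty := by
    have h₁ : Set.range α = LinearMap.fst ℝ (Fin k → ℝ) ℝ ''
        Set.range fun j => (α j, Real.log (1 / δ j)) := by
      rw [← Set.range_comp]; rfl
    rw [h₁, ← LinearMap.image_convexHull] at hα₀
    obtain ⟨⟨β, z⟩, hz, rfl⟩ := hα₀
    exact ⟨z, hz⟩
  obtain ⟨z, hz⟩ := hT.exists_isGreatest hne
  have hS : funS α δ α₀ = (z : EReal) := by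
    refine le_antisymm (sSup_le ?_) (le_sSup ⟨z, hz.1, rfl⟩)
    rintro _ ⟨y, hy, rfl⟩
    exact EReal.coe_le_coe_iff.2 (hz.2 hy)
  rw [hS]
  exact ⟨hz, rfl⟩

theorem le_of_mem_hullQ (h : ∀ j, Real.log (1 / δ j) ≤ α j ⬝ᵥ η + c) {β : Fin k → ℝ} {z : ℝ}
    (hz : (β, z) ∈ hullQ α δ) : z ≤ β ⬝ᵥ η + c := by
  have hconv : Convex ℝ {p : (Fin k → ℝ) × ℝ | p.2 ≤ p.1 ⬝ᵥ η + c} := by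
    rintro ⟨x, u⟩ hx ⟨y, v⟩ hy a b ha hb hab
    simp only [Set.mem_ofPred_eq, Prod.smul_mk, Prod.mk_add_mk, smul_eq_mul, add_dotProduct,
      smul_dotProduct] at hx hy ⊢
    have h₁ := mul_le_mul_of_nonneg_left hx ha
    have h₂ := mul_le_mul_of_nonneg_left hy hb
    have h₃ : a * c + b * c = c := by rw [← add_mul, hab, one_mul]
    linarith
  refine convexHull_min ?_ hconv hz
  rintro _ ⟨j, rfl⟩
  exact h j

theorem IsSupportHyperplane.log_le (h : IsSupportHyperplane α δ α₀ η c) (j : Fin N) :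
    Real.log (1 / δ j) ≤ α j ⬝ᵥ η + c := by
  have hmem : Real.log (1 / δ j) ∈ {z : ℝ | (α j, z) ∈ hullQ α δ} :=
    subset_convexHull ℝ _ ⟨j, rfl⟩
  have hle : ((Real.log (1 / δ j) : ℝ) : EReal) ≤ funS α δ (α j) := le_sSup ⟨_, hmem, rfl⟩
  exact EReal.coe_le_coe_iff.1 (hle.trans (h.2 (α j)))

theorem IsSupportHyperplane.toReal_funS (h : IsSupportHyperplane α δ α₀ η c) :
    (funS α δ α₀).toReal = α₀ ⬝ᵥ η + c := by
  rw [h.1, EReal.toReal_coe]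

theorem exists_isSupportHyperplane (hα₀ : α₀ ∈ convexHull ℝ (Set.range α)) :
    ∃ η c, IsSupportHyperplane α δ α₀ η c := by
  obtain ⟨⟨hmem, hub⟩, hS⟩ := isGreatest_toReal_funS (δ := δ) hα₀
  set s := (funS α δ α₀).toReal
  suffices H : ∃ (η : Fin k → ℝ) (c : ℝ),
      (∀ j, Real.log (1 / δ j) ≤ α j ⬝ᵥ η + c) ∧ α₀ ⬝ᵥ η + c ≤ s by
    obtain ⟨η, c, h, h₀⟩ := H
    refine ⟨η, c, ?_, fun β => sSup_le ?_⟩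
    · rw [hS, le_antisymm h₀ (le_of_mem_hullQ h hmem)]
    · rintro _ ⟨z, hz, rfl⟩
      exact EReal.coe_le_coe_iff.2 (le_of_mem_hullQ h hz)
  by_contra! H
  let ev : (Fin k → ℝ) → (Fin k → ℝ) × ℝ × ℝ →ₗ[ℝ] ℝ := fun β =>
    { toFun := fun v => β ⬝ᵥ v.1 + v.2.1
      map_add' := fun u v => by simp [dotProduct_add]; ring
      map_smul' := fun r v => by simp [mul_add] }
  let t : (Fin k → ℝ) × ℝ × ℝ →ₗ[ℝ] ℝ := LinearMap.snd ℝ ℝ ℝ ∘ₗ LinearMap.snd ℝ (Fin k → ℝ) (ℝ × ℝ)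
  let f : Option (Fin N) → (Fin k → ℝ) × ℝ × ℝ →ₗ[ℝ] ℝ := fun o =>
    o.elim (ev α₀ - s • t) fun j => Real.log (1 / δ j) • t - ev (α j)
  obtain ⟨w, hw, hsum⟩ := exists_nonneg_sum_eq_of_forall_nonpos Finset.univ f t fun v hv => by
    by_contra! hpos
    obtain ⟨η, c, r⟩ := v
    have hr : 0 < r := hpos
    refine absurd (H (r⁻¹ • η) (r⁻¹ * c) fun j => ?_) (not_lt.2 ?_)
    · have h₁ : Real.log (1 / δ j) * r - (α j ⬝ᵥ η + c) ≤ 0 := hv (some j) (Finset.mem_univ _)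
      rw [dotProduct_smul, smul_eq_mul, ← mul_add, ← div_eq_inv_mul, le_div_iff₀ hr]
      linarith
    · have h₁ : α₀ ⬝ᵥ η + c - s * r ≤ 0 := hv none (Finset.mem_univ _)
      rw [dotProduct_smul, smul_eq_mul, ← mul_add, ← div_eq_inv_mul, div_le_iff₀ hr]
      linarith
  have key : ∀ (η : Fin k → ℝ) (c r : ℝ), r = w none * (α₀ ⬝ᵥ η + c - s * r) +
      ∑ j, w (some j) * (Real.log (1 / δ j) * r - (α j ⬝ᵥ η + c)) := fun η c r => by
    have := LinearMap.congr_fun hsum (η, c, r)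
    rw [Fintype.sum_option] at this
    simpa [f, ev, t] using this
  have h₁ := key 0 1 0
  have h₂ := key 0 0 1
  simp only [dotProduct_zero, zero_add, mul_zero, sub_zero, mul_one, zero_sub, mul_neg,
    Finset.sum_neg_distrib, add_zero] at h₁ h₂
  have hμ : w none = ∑ j, w (some j) := by linarith
  have hμpos : 0 < w none := by
    refine lt_of_le_of_ne (hw none) fun h0 => ?_
    have hz : ∀ j, w (some j) = 0 := fun j =>
      (Finset.sum_eq_zero_iff_of_nonneg fun j _ => hw (some j)).1 (hμ.symm.trans h0.symm) j
        (Finset.mem_univ j)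
    simp [hz, ← h0] at h₂
  have h₃ : ∑ j, w (some j) • α j = w none • α₀ := by
    ext i
    have := key (Pi.single i 1) 0 0
    simp only [dotProduct_single, mul_one, add_zero, mul_zero, sub_zero, zero_sub, mul_neg,
      Finset.sum_neg_distrib] at this
    simp only [Finset.sum_apply, Pi.smul_apply, smul_eq_mul]
    linarith
  have h₄ : (α₀, (w none)⁻¹ * ∑ j, w (some j) * Real.log (1 / δ j)) ∈ hullQ α δ := by
    refine mem_convexHull_of_exists_fintype (fun j => (w none)⁻¹ * w (some j))
      (fun j => (α j, Real.log (1 / δ j))) (fun j => mul_nonneg (inv_nonneg.2 (hw _)) (hw _)) ?_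
      (fun j => ⟨j, rfl⟩) ?_
    · rw [← Finset.mul_sum, ← hμ, inv_mul_cancel₀ hμpos.ne']
    · refine Prod.ext ?_ ?_
      · simp only [Prod.fst_sum, Prod.smul_mk, mul_smul, ← Finset.smul_sum, h₃]
        rw [smul_smul, inv_mul_cancel₀ hμpos.ne', one_smul]
      · simp only [Prod.snd_sum, Prod.smul_mk, smul_eq_mul, mul_assoc, ← Finset.mul_sum]
  have h₅ := hub h₄
  rw [← div_eq_inv_mul, div_le_iff₀ hμpos] at h₅
  linarith

theorem IsSupportHyperplane.exists_isRepresentation (h : IsSupportHyperplane α δ α₀ η c)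
    (hα₀ : α₀ ∈ convexHull ℝ (Set.range α)) :
    ∃ J θ, IsRepresentation α δ α₀ η c J θ ∧ J.card ≤ k + 1 ∧
      AffineIndependent ℝ (fun j : J => α j) := by
  classical
  have hmem := (isGreatest_toReal_funS (δ := δ) hα₀).1.1
  rw [h.toReal_funS] at hmem
  obtain ⟨ι, _, z, w, hz, hind, hw, hw₁, hwz⟩ := eq_pos_convex_span_of_mem_convexHull hmem
  choose σ hσ using fun i => hz ⟨i, rfl⟩
  obtain rfl : z = fun i => (α (σ i), Real.log (1 / δ (σ i))) := funext fun i => (hσ i).symm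
  have h₁ : ∑ i, w i • α (σ i) = α₀ := by simpa [Prod.fst_sum] using congr_arg Prod.fst hwz
  have h₂ : ∑ i, w i * Real.log (1 / δ (σ i)) = α₀ ⬝ᵥ η + c := by
    simpa [Prod.snd_sum] using congr_arg Prod.snd hwz
  have hplane : ∀ i, Real.log (1 / δ (σ i)) = α (σ i) ⬝ᵥ η + c := by
    have h₃ : ∑ i, w i * Real.log (1 / δ (σ i)) = ∑ i, w i * (α (σ i) ⬝ᵥ η + c) := by
      rw [h₂, ← h₁, sum_dotProduct]
      simp only [mul_add, Finset.sum_add_distrib, ← Finset.sum_mul, hw₁, smul_dotProduct,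
        smul_eq_mul, one_mul]
    have h₄ := (Finset.sum_eq_sum_iff_of_le fun i _ =>
      mul_le_mul_of_nonneg_left (h.log_le (σ i)) (hw i).le).1 h₃
    exact fun i => mul_left_cancel₀ (hw i).ne' (h₄ i (Finset.mem_univ i))
  have hind' : AffineIndependent ℝ fun i => α (σ i) := by
    let g : (Fin k → ℝ) →ₗ[ℝ] ℝ :=
      { toFun := fun v => v ⬝ᵥ η
        map_add' := fun u v => add_dotProduct u v η
        map_smul' := fun r v => smul_dotProduct r v η }
    refine AffineIndependent.of_comp
      ((AffineMap.id ℝ (Fin k → ℝ)).prod (g.toAffineMap + AffineMap.const ℝ _ c)) ?_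
    have hcomp : ((AffineMap.id ℝ (Fin k → ℝ)).prod (g.toAffineMap + AffineMap.const ℝ _ c)) ∘
        (fun i => α (σ i)) = fun i => (α (σ i), Real.log (1 / δ (σ i))) :=
      funext fun i => Prod.ext rfl (hplane i).symm
    rw [hcomp]
    exact hind
  have hinj : Function.Injective σ := fun i j hij => hind'.injective (by simp [hij])
  have hJ : ∀ (M : Type) [AddCommMonoid M] (F : Fin N → ι → M),
      ∑ j ∈ Finset.univ.image σ, ∑ i, (if σ i = j then F j i else 0) = ∑ i, F (σ i) i := by
    intro M _ F
    rw [Finset.sum_image fun i _ j _ hij => hinj hij]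
    simp [hinj.eq_iff]
  refine ⟨Finset.univ.image σ, fun j => ∑ i, if σ i = j then w i else 0, ⟨?_, ?_, ?_, ?_⟩, ?_, ?_⟩
  · simp only [Finset.mem_image, Finset.mem_univ, true_and, forall_exists_index,
      forall_apply_eq_imp_iff]
    exact hplane
  · simp only [Finset.mem_image, Finset.mem_univ, true_and, forall_exists_index,
      forall_apply_eq_imp_iff]
    intro i
    simp [hinj.eq_iff, hw i]
  · rw [hJ ℝ fun _ i => w i, hw₁]
  · simp only [Finset.sum_smul, ite_smul, zero_smul]
    rw [hJ _ fun j i => w i • α j, h₁]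
  · rw [Finset.card_image_of_injective _ hinj, Finset.card_univ]
    refine hind'.card_le_finrank_succ.trans ?_
    have := Submodule.finrank_le (vectorSpan ℝ (Set.range fun i => α (σ i)))
    simp only [Module.finrank_fin_fun] at this
    lia
  · let e : ι ≃ (Finset.univ.image σ : Finset (Fin N)) := Equiv.ofBijective
      (fun i => ⟨σ i, Finset.mem_image_of_mem σ (Finset.mem_univ i)⟩)
      ⟨fun i j hij => hinj (congr_arg Subtype.val hij), fun ⟨j, hj⟩ => by
        obtain ⟨i, -, rfl⟩ := Finset.mem_image.1 hj
        exact ⟨i, rfl⟩⟩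
    exact (affineIndependent_equiv e).1 hind'

theorem IsRepresentation.sum_mul_log {J : Finset (Fin N)} {θ : Fin N → ℝ}
    (h : IsRepresentation α δ α₀ η c J θ) :
    ∑ j ∈ J, θ j * Real.log (1 / δ j) = α₀ ⬝ᵥ η + c := by
  rw [← h.sum_eq, sum_dotProduct, Finset.sum_congr rfl fun j hj => by rw [h.mem_hyperplane j hj]]
  simp only [mul_add, Finset.sum_add_distrib, ← Finset.sum_mul, h.sum_eq_one, smul_dotProduct,
    smul_eq_mul, one_mul]

theorem IsRepresentation.prod_rpow {J : Finset (Fin N)} {θ : Fin N → ℝ}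
    (h : IsRepresentation α δ α₀ η c J θ) (hδ : ∀ j, 0 < δ j) :
    ∏ j ∈ J, δ j ^ θ j = Real.exp (-(α₀ ⬝ᵥ η + c)) := by
  rw [← h.sum_mul_log, ← Finset.sum_neg_distrib, Real.exp_sum]
  refine Finset.prod_congr rfl fun j _ => ?_
  rw [Real.rpow_def_of_pos (hδ j), one_div, Real.log_inv]
  congr 1
  ring

end FunS

/-! ### Powers of the symbols -/

section Symbol

variable {d k N : ℕ} {φ : Fin k → Rd d → ℂ}

theorem norm_powSymbol (φ : Fin k → Rd d → ℂ) (β : Fin k → ℝ) (ξ : Rd d) :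
    ‖powSymbol φ β ξ‖ = ∏ i, ‖φ i ξ‖ ^ β i := by
  simp [powSymbol, norm_prod, Complex.norm_cpow_real]

theorem measurable_powSymbol (hφ : ∀ i, Continuous (φ i)) (β : Fin k → ℝ) :
    Measurable (powSymbol φ β) :=
  Finset.measurable_prod _ fun i _ => (hφ i).measurable.pow_const _

theorem IsRepresentation.norm_powSymbol {α : Fin N → Fin k → ℝ} {δ : Fin N → ℝ}
    {α₀ η : Fin k → ℝ} {c : ℝ} {J : Finset (Fin N)} {θ : Fin N → ℝ}
    (h : IsRepresentation α δ α₀ η c J θ) (hα : ∀ j i, 0 ≤ α j i) (φ : Fin k → Rd d → ℂ)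
    (ξ : Rd d) :
    ‖powSymbol φ α₀ ξ‖ = ∏ j ∈ J, ‖powSymbol φ (α j) ξ‖ ^ θ j := by
  simp only [OptimalRecovery.norm_powSymbol]
  rw [Finset.prod_congr rfl fun j _ => (Real.finsetProd_rpow _ _
    (fun i _ => Real.rpow_nonneg (norm_nonneg (φ i ξ)) (α j i)) (θ j)).symm, Finset.prod_comm]
  refine Finset.prod_congr rfl fun i _ => ?_
  rw [← h.sum_eq, Finset.sum_apply]
  simp only [Pi.smul_apply, smul_eq_mul]
  rw [Real.rpow_sum_of_nonneg (norm_nonneg _) fun j hj => mul_nonneg (h.pos j hj).le (hα j i)]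
  refine Finset.prod_congr rfl fun j _ => ?_
  rw [mul_comm, Real.rpow_mul (norm_nonneg _)]

theorem exists_norm_powSymbol_eq_exp
    (hsurj : ∀ b : Fin k → ℝ, (∀ i, 0 < b i) → ∃ ξ : Rd d, ∀ i, ‖φ i ξ‖ = b i) (η : Fin k → ℝ) :
    ∃ ξ, (∀ i, φ i ξ ≠ 0) ∧ ∀ β, ‖powSymbol φ β ξ‖ = Real.exp (-(β ⬝ᵥ η)) := by
  obtain ⟨ξ, hξ⟩ := hsurj (fun i => Real.exp (-η i)) fun i => Real.exp_pos _
  refine ⟨ξ, fun i => norm_pos_iff.1 (hξ i ▸ Real.exp_pos _), fun β => ?_⟩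
  rw [norm_powSymbol, dotProduct, ← Finset.sum_neg_distrib, Real.exp_sum]
  refine Finset.prod_congr rfl fun i _ => ?_
  rw [hξ, ← Real.exp_mul]
  congr 1
  ring

theorem continuousAt_norm_powSymbol (hφ : ∀ i, Continuous (φ i)) {ξ : Rd d}
    (hξ : ∀ i, φ i ξ ≠ 0) (β : Fin k → ℝ) : ContinuousAt (fun ζ => ‖powSymbol φ β ζ‖) ξ := by
  simp only [norm_powSymbol]
  exact tendsto_finsetProd _ fun i _ =>
    ((hφ i).norm.continuousAt).rpow_const (Or.inl (norm_ne_zero_iff.2 (hξ i)))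

end Symbol

/-! ### Norms in `L₂` -/

section ELpNorm

variable {X ι : Type*} [MeasurableSpace X] {μ : Measure X}

theorem eLpNorm_two_sq (f : X → ℂ) : eLpNorm f 2 μ ^ 2 = ∫⁻ x, ‖f x‖ₑ ^ 2 ∂μ := by
  have := eLpNorm_nnreal_pow_eq_lintegral (p := 2) (f := f) (μ := μ) two_ne_zero
  simpa using this

/-- Hölder's inequality in `L₂`. -/
theorem eLpNorm_two_le_prod_rpow (s : Finset ι) {f : ι → X → ℂ} {g : X → ℂ} {θ : ι → ℝ}
    (hf : ∀ i ∈ s, AEStronglyMeasurable (f i) μ) (hθ : ∀ i ∈ s, 0 ≤ θ i) (hθ₁ : ∑ i ∈ s, θ i = 1)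
    (hg : ∀ x, ‖g x‖ₑ ≤ ∏ i ∈ s, ‖f i x‖ₑ ^ θ i) :
    eLpNorm g 2 μ ≤ ∏ i ∈ s, eLpNorm (f i) 2 μ ^ θ i := by
  have hcomm : ∀ (a : ℝ≥0∞) (t : ℝ), (a ^ t) ^ 2 = (a ^ 2) ^ t := fun a t => by
    rw [← ENNReal.rpow_natCast, ← ENNReal.rpow_natCast, ← ENNReal.rpow_mul, ← ENNReal.rpow_mul,
      mul_comm]
  rw [← ENNReal.pow_le_pow_left_iff two_ne_zero, eLpNorm_two_sq,
    ← Finset.prod_pow]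
  calc ∫⁻ x, ‖g x‖ₑ ^ 2 ∂μ ≤ ∫⁻ x, ∏ i ∈ s, (‖f i x‖ₑ ^ 2) ^ θ i ∂μ := by
        refine lintegral_mono fun x => ?_
        simp only [← hcomm, Finset.prod_pow]
        exact pow_le_pow_left₀ zero_le (hg x) 2
    _ ≤ ∏ i ∈ s, (∫⁻ x, ‖f i x‖ₑ ^ 2 ∂μ) ^ θ i :=
        ENNReal.lintegral_prod_norm_pow_le s (fun i hi => (hf i hi).enorm.pow_const 2) hθ₁ hθ
    _ = _ := Finset.prod_congr rfl fun i _ => by rw [← eLpNorm_two_sq, hcomm]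

/-- A weighted Cauchy–Schwarz inequality. -/
theorem norm_sum_mul_sq_le (s : Finset ι) (a u : ι → ℂ) {δ θ : ι → ℝ} (hδ : ∀ i ∈ s, 0 < δ i)
    (hθ : ∀ i ∈ s, 0 < θ i) :
    ‖∑ i ∈ s, a i * u i‖ ^ 2 ≤
      (∑ i ∈ s, δ i ^ 2 * ‖a i‖ ^ 2 / θ i) * ∑ i ∈ s, θ i / δ i ^ 2 * ‖u i‖ ^ 2 := by
  have h₁ : ‖∑ i ∈ s, a i * u i‖ ≤
      ∑ i ∈ s, (δ i * ‖a i‖ / √(θ i)) * (√(θ i) / δ i * ‖u i‖) := by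
    refine (norm_sum_le _ _).trans (Finset.sum_le_sum fun i hi => le_of_eq ?_)
    have h₂ := (hδ i hi).ne'
    have h₃ := (Real.sqrt_pos.2 (hθ i hi)).ne'
    rw [norm_mul]
    field_simp
  refine (pow_le_pow_left₀ (norm_nonneg _) h₁ 2).trans
    ((Finset.sum_mul_sq_le_sq_mul_sq s _ _).trans (le_of_eq ?_))
  congr 1 <;> refine Finset.sum_congr rfl fun i hi => ?_
  · rw [div_pow, mul_pow, Real.sq_sqrt (hθ i hi).le]
  · rw [mul_pow, div_pow, Real.sq_sqrt (hθ i hi).le]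

theorem eLpNorm_two_sum_mul_le (s : Finset ι) {a u : ι → X → ℂ} {δ θ : ι → ℝ} {A : ℝ}
    (hA : 0 ≤ A) (hδ : ∀ i ∈ s, 0 < δ i) (hθ : ∀ i ∈ s, 0 < θ i) (hθ₁ : ∑ i ∈ s, θ i = 1)
    (hu : ∀ i ∈ s, AEStronglyMeasurable (u i) μ)
    (ha : ∀ᵐ x ∂μ, ∑ i ∈ s, δ i ^ 2 * ‖a i x‖ ^ 2 / θ i ≤ A ^ 2)
    (huδ : ∀ i ∈ s, eLpNorm (u i) 2 μ ≤ ENNReal.ofReal (δ i)) :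
    eLpNorm (fun x => ∑ i ∈ s, a i x * u i x) 2 μ ≤ ENNReal.ofReal A := by
  have hsq : ∀ z : ℂ, ‖z‖ₑ ^ 2 = ENNReal.ofReal (‖z‖ ^ 2) := fun z => by
    rw [ENNReal.ofReal_pow (norm_nonneg _), ofReal_norm]
  rw [← ENNReal.pow_le_pow_left_iff two_ne_zero, eLpNorm_two_sq]
  calc ∫⁻ x, ‖∑ i ∈ s, a i x * u i x‖ₑ ^ 2 ∂μ
      ≤ ∫⁻ x, ENNReal.ofReal (A ^ 2) * ∑ i ∈ s, ENNReal.ofReal (θ i / δ i ^ 2) * ‖u i x‖ₑ ^ 2 ∂μ := by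
        refine lintegral_mono_ae ?_
        filter_upwards [ha] with x hx
        have hnn : ∀ i ∈ s, 0 ≤ θ i / δ i ^ 2 * ‖u i x‖ ^ 2 := fun i hi => by
          have := hθ i hi
          positivity
        have h₁ : ∑ i ∈ s, ENNReal.ofReal (θ i / δ i ^ 2) * ‖u i x‖ₑ ^ 2 =
            ENNReal.ofReal (∑ i ∈ s, θ i / δ i ^ 2 * ‖u i x‖ ^ 2) := by
          rw [ENNReal.ofReal_sum_of_nonneg hnn]
          refine Finset.sum_congr rfl fun i hi => ?_
          rw [hsq, ENNReal.ofReal_mul (div_nonneg (hθ i hi).le (sq_nonneg _))]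
        rw [h₁, hsq, ← ENNReal.ofReal_mul (sq_nonneg A)]
        exact ENNReal.ofReal_le_ofReal ((norm_sum_mul_sq_le s _ _ hδ hθ).trans
          (mul_le_mul_of_nonneg_right hx (Finset.sum_nonneg hnn)))
    _ = ENNReal.ofReal (A ^ 2) * ∑ i ∈ s, ENNReal.ofReal (θ i / δ i ^ 2) * eLpNorm (u i) 2 μ ^ 2 := by
        rw [lintegral_const_mul' _ _ ENNReal.ofReal_ne_top, lintegral_finsetSum' _ fun i hi =>
          ((hu i hi).enorm.pow_const 2).const_mul _]
        congr 1
        refine Finset.sum_congr rfl fun i _ => ?_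
        rw [lintegral_const_mul' _ _ ENNReal.ofReal_ne_top, eLpNorm_two_sq]
    _ ≤ ENNReal.ofReal (A ^ 2) * ∑ i ∈ s, ENNReal.ofReal (θ i) := by
        gcongr with i hi
        refine (mul_le_mul_right (pow_le_pow_left₀ zero_le (huδ i hi) 2) _).trans (le_of_eq ?_)
        rw [← ENNReal.ofReal_pow (hδ i hi).le,
          ← ENNReal.ofReal_mul (div_nonneg (hθ i hi).le (sq_nonneg _)),
          div_mul_cancel₀ _ (pow_ne_zero 2 (hδ i hi).ne')]
    _ = ENNReal.ofReal A ^ 2 := by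
        rw [← ENNReal.ofReal_sum_of_nonneg fun i hi => (hθ i hi).le, hθ₁, ENNReal.ofReal_one, mul_one,
          ENNReal.ofReal_pow hA]

end ELpNorm

/-! ### Fourier multipliers -/

section Multiplier

variable {d k N : ℕ} {φ : Fin k → Rd d → ℂ} {f g : Rd d → ℂ}

theorem invFourier_of_memLp (hf : MemLp f 2 (volume : Measure (Rd d))) :
    invFourier f = 𝓕⁻ (hf.toLp f) := dif_pos hf

theorem fourier_invFourier (hf : MemLp f 2 (volume : Measure (Rd d))) :
    (𝓕 (invFourier f) : L2 d) =ᵐ[volume] f := by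
  rw [invFourier_of_memLp hf, FourierTransform.fourier_fourierInv_eq]
  exact hf.coeFn_toLp

theorem enorm_invFourier (hf : MemLp f 2 (volume : Measure (Rd d))) :
    ‖invFourier f‖ₑ = eLpNorm f 2 volume := by
  have h : ‖(𝓕⁻ (hf.toLp f) : L2 d)‖ = ‖hf.toLp f‖ :=
    (Lp.fourierTransformₗᵢ (Rd d) ℂ).symm.norm_map _
  rw [invFourier_of_memLp hf, ← ofReal_norm, h, ofReal_norm, Lp.enorm_toLp]

theorem invFourier_sub (hf : MemLp f 2 (volume : Measure (Rd d)))
    (hg : MemLp g 2 (volume : Measure (Rd d))) :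
    invFourier f - invFourier g = invFourier (fun ξ => f ξ - g ξ) := by
  have h : invFourier (fun ξ => f ξ - g ξ) = 𝓕⁻ ((hf.sub hg).toLp (f - g)) := dif_pos (hf.sub hg)
  rw [h, invFourier_of_memLp hf, invFourier_of_memLp hg, MemLp.toLp_sub]
  exact ((Lp.fourierTransformₗᵢ (Rd d) ℂ).symm.map_sub _ _).symm

theorem invFourier_congr (h : f =ᵐ[volume] g) : invFourier f = invFourier g := by
  by_cases hf : MemLp f 2 (volume : Measure (Rd d))
  · have hg := (memLp_congr_ae h).1 hf
    rw [invFourier_of_memLp hf, invFourier_of_memLp hg, (MemLp.toLp_eq_toLp_iff hf hg).2 h]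
  · rw [invFourier, invFourier, dif_neg hf, dif_neg fun hg => hf ((memLp_congr_ae h).2 hg)]

theorem invFourier_zero : invFourier (fun _ : Rd d => (0 : ℂ)) = 0 := by
  have h : MemLp (fun _ : Rd d => (0 : ℂ)) 2 volume := MemLp.zero'
  rw [← enorm_eq_zero, enorm_invFourier h, eLpNorm_zero']

theorem fourier_neg_ae (x : L2 d) : (𝓕 (-x) : L2 d) =ᵐ[volume] fun ξ => -(𝓕 x : L2 d) ξ := by
  have h : (𝓕 (-x) : L2 d) = -(𝓕 x : L2 d) := (Lp.fourierTransformₗᵢ (Rd d) ℂ).map_neg x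
  rw [h]
  exact Lp.coeFn_neg _

theorem mul_fourier_neg_ae (β : Fin k → ℝ) (x : L2 d) :
    (fun ξ => powSymbol φ β ξ * (𝓕 (-x) : L2 d) ξ) =ᵐ[volume]
      -(fun ξ => powSymbol φ β ξ * (𝓕 x : L2 d) ξ) := by
  filter_upwards [fourier_neg_ae x] with ξ hξ
  rw [hξ, Pi.neg_apply, mul_neg]

theorem neg_mem_smoothSpace {α : Fin N → Fin k → ℝ} {x : L2 d} (hx : x ∈ smoothSpace φ α) :
    -x ∈ smoothSpace φ α := fun j =>
  (memLp_congr_ae (mul_fourier_neg_ae (α j) x)).2 (hx j).neg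

theorem multOp_neg (β : Fin k → ℝ) (x : L2 d)
    (hx : MemLp (fun ξ => powSymbol φ β ξ * (𝓕 x : L2 d) ξ) 2 (volume : Measure (Rd d))) :
    multOp φ β (-x) = -multOp φ β x := by
  have h := invFourier_sub (MemLp.zero' (p := 2) (μ := (volume : Measure (Rd d))) (ε := ℂ)) hx
  rw [invFourier_zero, zero_sub] at h
  rw [multOp, invFourier_congr (mul_fourier_neg_ae β x), multOp, h]
  simp only [zero_sub]
  rfl

/-- There are functions of the space whose Fourier transforms concentrate near a point `ξ` with
`|φ_i(ξ)| = e^{-η_i}`. -/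
theorem exists_mem_smoothSpace_lt_norm_multOp (hφ : ∀ i, Continuous (φ i))
    (hsurj : ∀ b : Fin k → ℝ, (∀ i, 0 < b i) → ∃ ξ : Rd d, ∀ i, ‖φ i ξ‖ = b i)
    (α : Fin N → Fin k → ℝ) (α₀ η : Fin k → ℝ) (c : ℝ) {C : ℝ}
    (hC : C < Real.exp (-(α₀ ⬝ᵥ η + c))) :
    ∃ x ∈ smoothSpace φ α, (∀ j, ‖multOp φ (α j) x‖ ≤ Real.exp (-(α j ⬝ᵥ η + c))) ∧
      C < ‖multOp φ α₀ x‖ := by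
  obtain ⟨r, hr₀, hr₁, hrC⟩ : ∃ r : ℝ, 0 < r ∧ r < 1 ∧ C < r * r * Real.exp (-(α₀ ⬝ᵥ η + c)) := by
    have h : Filter.Tendsto (fun r : ℝ => r * r * Real.exp (-(α₀ ⬝ᵥ η + c))) (nhdsWithin 1 (Set.Iio 1))
        (nhds (1 * 1 * Real.exp (-(α₀ ⬝ᵥ η + c)))) :=
      (Continuous.tendsto (by fun_prop) 1).mono_left nhdsWithin_le_nhds
    rw [one_mul, one_mul] at h
    obtain ⟨r, h₁, h₂, h₃⟩ := ((h.eventually (lt_mem_nhds hC)).and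
      ((Ioo_mem_nhdsLT (zero_lt_one (α := ℝ))))).exists
    exact ⟨r, h₂, h₃, h₁⟩
  obtain ⟨ξ₀, hξ₀, hexp⟩ := exists_norm_powSymbol_eq_exp hsurj η
  have hup : ∀ β : Fin k → ℝ, ∀ᶠ ξ in nhds ξ₀, ‖powSymbol φ β ξ‖ < Real.exp (-(β ⬝ᵥ η)) / r :=
    fun β => (continuousAt_norm_powSymbol hφ hξ₀ β).eventually_lt_const (by
      simp only [hexp]
      rw [lt_div_iff₀ hr₀]
      exact mul_lt_of_lt_one_right (Real.exp_pos _) hr₁)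
  have hlow : ∀ᶠ ξ in nhds ξ₀, r * Real.exp (-(α₀ ⬝ᵥ η)) < ‖powSymbol φ α₀ ξ‖ :=
    (continuousAt_norm_powSymbol hφ hξ₀ α₀).eventually_const_lt (by
      simp only [hexp]
      exact mul_lt_of_lt_one_left (Real.exp_pos _) hr₁)
  obtain ⟨ρ, hρ, hball⟩ := Metric.eventually_nhds_iff_ball.1
    ((Filter.eventually_all.2 fun j => hup (α j)).and ((hup α₀).and hlow))
  set B := Metric.ball ξ₀ ρ with hB
  have hBm : MeasurableSet B := measurableSet_ball
  set f₀ : Rd d → ℂ := B.indicator fun _ => 1 with hf₀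
  have hf₀L : MemLp f₀ 2 volume :=
    memLp_indicator_const 2 hBm 1 (Or.inr measure_ball_lt_top.ne)
  set n₀ := (eLpNorm f₀ 2 volume).toReal with hn₀
  have hn₀pos : 0 < n₀ := by
    refine ENNReal.toReal_pos ?_ hf₀L.2.ne
    rw [hf₀, eLpNorm_indicator_const hBm two_ne_zero ENNReal.ofNat_ne_top]
    simp [(Metric.measure_ball_pos volume ξ₀ hρ).ne', hB, measure_ball_lt_top.ne]
  set K : ℝ := Real.exp (-c) * r / n₀ with hK
  have hKpos : 0 < K := by positivity
  set f : Rd d → ℂ := (K : ℂ) • f₀ with hf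
  have hfL : MemLp f 2 volume := hf₀L.const_smul _
  have hfnorm : eLpNorm f 2 volume = ENNReal.ofReal (Real.exp (-c) * r) := by
    rw [hf, eLpNorm_const_smul, ← ENNReal.ofReal_toReal hf₀L.2.ne, ← hn₀, ← ofReal_norm,
      Complex.norm_real, Real.norm_of_nonneg hKpos.le, ← ENNReal.ofReal_mul hKpos.le, hK,
      div_mul_cancel₀ _ hn₀pos.ne']
  have hfB : ∀ ξ ∉ B, f ξ = 0 := fun ξ hξ => by simp [hf, hf₀, hξ]
  set x := invFourier f with hx
  have hmul : ∀ β : Fin k → ℝ, (fun ξ => powSymbol φ β ξ * (𝓕 x : L2 d) ξ) =ᵐ[volume]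
      fun ξ => powSymbol φ β ξ * f ξ := fun β => by
    filter_upwards [fourier_invFourier hfL] with ξ hξ
    rw [hx, hξ]
  have hle : ∀ β : Fin k → ℝ, (∀ ξ ∈ B, ‖powSymbol φ β ξ‖ < Real.exp (-(β ⬝ᵥ η)) / r) →
      ∀ ξ, ‖powSymbol φ β ξ * f ξ‖ ≤ Real.exp (-(β ⬝ᵥ η)) / r * ‖f ξ‖ := fun β hβ ξ => by
    by_cases hξ : ξ ∈ B
    · rw [norm_mul]
      exact mul_le_mul_of_nonneg_right (hβ ξ hξ).le (norm_nonneg _)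
    · simp [hfB ξ hξ]
  have hmem : ∀ β : Fin k → ℝ, (∀ ξ ∈ B, ‖powSymbol φ β ξ‖ < Real.exp (-(β ⬝ᵥ η)) / r) →
      MemLp (fun ξ => powSymbol φ β ξ * f ξ) 2 volume := fun β hβ =>
    hfL.of_le_mul ((measurable_powSymbol hφ β).aestronglyMeasurable.mul hfL.1)
      (Filter.Eventually.of_forall (hle β hβ))
  have henorm : ∀ β : Fin k → ℝ, (∀ ξ ∈ B, ‖powSymbol φ β ξ‖ < Real.exp (-(β ⬝ᵥ η)) / r) →
      ‖multOp φ β x‖ₑ = eLpNorm (fun ξ => powSymbol φ β ξ * f ξ) 2 volume := fun β hβ => by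
    rw [multOp, invFourier_congr (hmul β), enorm_invFourier (hmem β hβ)]
  refine ⟨x, fun j => (memLp_congr_ae (hmul (α j))).2 (hmem _ fun ξ hξ => (hball ξ hξ).1 j),
    fun j => ?_, ?_⟩
  · have h₁ := henorm (α j) fun ξ hξ => (hball ξ hξ).1 j
    have h₂ := eLpNorm_le_mul_eLpNorm_of_ae_le_mul (μ := volume)
      (Filter.Eventually.of_forall (hle (α j) fun ξ hξ => (hball ξ hξ).1 j)) 2
    rw [← h₁, hfnorm, ← ENNReal.ofReal_mul (by positivity), ← ofReal_norm,
      ENNReal.ofReal_le_ofReal_iff (by positivity)] at h₂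
    refine h₂.trans (le_of_eq ?_)
    rw [neg_add, Real.exp_add]
    field_simp
  · refine hrC.trans_le ?_
    have h₁ := henorm α₀ fun ξ hξ => (hball ξ hξ).2.1
    have h₂ : ∀ ξ, ‖f ξ‖ ≤ (r * Real.exp (-(α₀ ⬝ᵥ η)))⁻¹ * ‖powSymbol φ α₀ ξ * f ξ‖ := fun ξ => by
      by_cases hξ : ξ ∈ B
      · rw [norm_mul, ← div_eq_inv_mul, le_div_iff₀ (by positivity), mul_comm]
        exact mul_le_mul_of_nonneg_right (hball ξ hξ).2.2.le (norm_nonneg _)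
      · simp [hfB ξ hξ]
    have h₃ := eLpNorm_le_mul_eLpNorm_of_ae_le_mul (μ := volume)
      (Filter.Eventually.of_forall h₂) 2
    rw [← h₁, hfnorm, ← ofReal_norm, ← ENNReal.ofReal_mul (by positivity),
      ENNReal.ofReal_le_ofReal_iff (by positivity), ← div_eq_inv_mul,
      le_div_iff₀ (by positivity)] at h₃
    refine le_trans (le_of_eq ?_) h₃
    rw [neg_add, Real.exp_add]
    ring

end Multiplier

/-! ### The inequality between the norms -/

section Main

variable {d k N m : ℕ} {φ : Fin k → Rd d → ℂ} {α : Fin N → Fin k → ℝ} {δ : Fin N → ℝ}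
  {α₀ η : Fin k → ℝ} {c : ℝ} {J : Finset (Fin N)} {θ : Fin N → ℝ}

theorem enorm_multOp {β : Fin k → ℝ} {x : L2 d}
    (hx : MemLp (fun ξ => powSymbol φ β ξ * (𝓕 x : L2 d) ξ) 2 (volume : Measure (Rd d))) :
    ‖multOp φ β x‖ₑ = eLpNorm (fun ξ => powSymbol φ β ξ * (𝓕 x : L2 d) ξ) 2 volume :=
  enorm_invFourier hx

theorem IsRepresentation.eLpNorm_le (h : IsRepresentation α δ α₀ η c J θ)
    (hφ : ∀ i, Continuous (φ i)) (hα : ∀ j i, 0 ≤ α j i) (x : L2 d) :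
    eLpNorm (fun ξ => powSymbol φ α₀ ξ * (𝓕 x : L2 d) ξ) 2 volume ≤
      ∏ j ∈ J, eLpNorm (fun ξ => powSymbol φ (α j) ξ * (𝓕 x : L2 d) ξ) 2 volume ^ θ j := by
  refine eLpNorm_two_le_prod_rpow J (fun j _ => (measurable_powSymbol hφ _).aestronglyMeasurable.mul
    (Lp.aestronglyMeasurable _)) (fun j hj => (h.pos j hj).le) h.sum_eq_one fun ξ => le_of_eq ?_
  have hnn : ∀ j ∈ J, 0 ≤ ‖powSymbol φ (α j) ξ * (𝓕 x : L2 d) ξ‖ ^ θ j := fun j _ =>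
    Real.rpow_nonneg (norm_nonneg _) _
  have hreal : ‖powSymbol φ α₀ ξ * (𝓕 x : L2 d) ξ‖ =
      ∏ j ∈ J, ‖powSymbol φ (α j) ξ * (𝓕 x : L2 d) ξ‖ ^ θ j := by
    simp only [norm_mul, Real.mul_rpow (norm_nonneg _) (norm_nonneg _), Finset.prod_mul_distrib]
    rw [← Real.rpow_sum_of_nonneg (norm_nonneg _) fun j hj => (h.pos j hj).le, h.sum_eq_one,
      Real.rpow_one, h.norm_powSymbol hα]
  rw [← ofReal_norm, hreal, ENNReal.ofReal_prod_of_nonneg hnn]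
  refine Finset.prod_congr rfl fun j hj => ?_
  rw [← ENNReal.ofReal_rpow_of_nonneg (norm_nonneg _) (h.pos j hj).le, ofReal_norm]

theorem IsRepresentation.memLp (h : IsRepresentation α δ α₀ η c J θ)
    (hφ : ∀ i, Continuous (φ i)) (hα : ∀ j i, 0 ≤ α j i) {x : L2 d} (hx : x ∈ smoothSpace φ α) :
    MemLp (fun ξ => powSymbol φ α₀ ξ * (𝓕 x : L2 d) ξ) 2 (volume : Measure (Rd d)) :=
  ⟨(measurable_powSymbol hφ _).aestronglyMeasurable.mul (Lp.aestronglyMeasurable _),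
    (h.eLpNorm_le hφ hα x).trans_lt (ENNReal.prod_lt_top fun j hj =>
      ENNReal.rpow_lt_top_of_nonneg (h.pos j hj).le (hx j).2.ne)⟩

theorem IsRepresentation.norm_multOp_le (h : IsRepresentation α δ α₀ η c J θ)
    (hφ : ∀ i, Continuous (φ i)) (hα : ∀ j i, 0 ≤ α j i) {x : L2 d} (hx : x ∈ smoothSpace φ α) :
    ‖multOp φ α₀ x‖ ≤ ∏ j ∈ J, ‖multOp φ (α j) x‖ ^ θ j := by
  have hnn : ∀ j ∈ J, 0 ≤ ‖multOp φ (α j) x‖ ^ θ j := fun j _ => Real.rpow_nonneg (norm_nonneg _) _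
  rw [← ENNReal.ofReal_le_ofReal_iff (Finset.prod_nonneg hnn), ENNReal.ofReal_prod_of_nonneg hnn,
    ofReal_norm, enorm_multOp (h.memLp hφ hα hx)]
  refine (h.eLpNorm_le hφ hα x).trans (le_of_eq (Finset.prod_congr rfl fun j hj => ?_))
  rw [← ENNReal.ofReal_rpow_of_nonneg (norm_nonneg _) (h.pos j hj).le, ofReal_norm,
    enorm_multOp (hx j)]

theorem IsSupportHyperplane.exp_le (h : IsSupportHyperplane α δ α₀ η c) (hδ : ∀ j, 0 < δ j)
    (j : Fin N) : Real.exp (-(α j ⬝ᵥ η + c)) ≤ δ j := by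
  have := h.log_le j
  rw [one_div, Real.log_inv] at this
  rw [← Real.le_log_iff_exp_le (hδ j)]
  linarith

theorem IsRepresentation.nonempty (h : IsRepresentation α δ α₀ η c J θ) : J.Nonempty := by
  rw [Finset.nonempty_iff_ne_empty]
  rintro rfl
  simpa using h.sum_eq_one

/-- If bounds `t_j` for `‖Λ_j x‖` are not below `e^{-⟨α^j, η⟩ - c}`, then `‖Λ₀ x‖` can be as close to
`e^{-⟨α₀, η⟩ - c}` as desired. -/
theorem ofReal_exp_le_iSup {ι : Type*} (hφ : ∀ i, Continuous (φ i))
    (hsurj : ∀ b : Fin k → ℝ, (∀ i, 0 < b i) → ∃ ξ : Rd d, ∀ i, ‖φ i ξ‖ = b i)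
    (σ : ι → Fin N) (t : ι → ℝ) (ht : ∀ i, Real.exp (-(α (σ i) ⬝ᵥ η + c)) ≤ t i) :
    ENNReal.ofReal (Real.exp (-(α₀ ⬝ᵥ η + c))) ≤
      ⨆ (x : L2 d) (_ : x ∈ smoothSpace φ α) (_ : ∀ i, ‖multOp φ (α (σ i)) x‖ ≤ t i),
        ‖multOp φ α₀ x‖ₑ := by
  refine le_of_forall_lt fun a ha => ?_
  have hatop : a ≠ ⊤ := (ha.trans ENNReal.ofReal_lt_top).ne
  obtain ⟨x, hx, hxle, hlt⟩ := exists_mem_smoothSpace_lt_norm_multOp hφ hsurj α α₀ η c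
    (C := a.toReal) ((ENNReal.lt_ofReal_iff_toReal_lt hatop).1 ha)
  refine lt_of_lt_of_le ?_ (le_iSup₂_of_le x hx (le_iSup_of_le
    (fun i => (hxle (σ i)).trans (ht i)) le_rfl))
  rw [← ofReal_norm]
  exact (ENNReal.lt_ofReal_iff_toReal_lt hatop).2 hlt

theorem IsRepresentation.one_le_of_forall_norm_le (h : IsRepresentation α δ α₀ η c J θ)
    (hφ : ∀ i, Continuous (φ i))
    (hsurj : ∀ b : Fin k → ℝ, (∀ i, 0 < b i) → ∃ ξ : Rd d, ∀ i, ‖φ i ξ‖ = b i) {C : ℝ}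
    (hC : ∀ x ∈ smoothSpace φ α, ‖multOp φ α₀ x‖ ≤ C * ∏ j ∈ J, ‖multOp φ (α j) x‖ ^ θ j) :
    1 ≤ C := by
  by_contra! hC₁
  obtain ⟨x, hx, hxle, hlt⟩ := exists_mem_smoothSpace_lt_norm_multOp hφ hsurj α α₀ 0 0
    (C := max C 0) (by simpa using hC₁)
  have h₁ : ∏ j ∈ J, ‖multOp φ (α j) x‖ ^ θ j ≤ 1 := by
    refine Finset.prod_le_one (fun j _ => Real.rpow_nonneg (norm_nonneg _) _) fun j hj => ?_
    exact Real.rpow_le_one (norm_nonneg _) (by simpa using hxle j) (h.pos j hj).le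
  have h₀ : 0 ≤ ∏ j ∈ J, ‖multOp φ (α j) x‖ ^ θ j :=
    Finset.prod_nonneg fun j _ => Real.rpow_nonneg (norm_nonneg _) _
  have h₂ := hC x hx
  have h₃ : C * ∏ j ∈ J, ‖multOp φ (α j) x‖ ^ θ j ≤ max C 0 * 1 :=
    mul_le_mul (le_max_left _ _) h₁ h₀ (le_max_right _ _)
  linarith

theorem IsRepresentation.iSup_enorm_multOp (h : IsRepresentation α δ α₀ η c J θ)
    (hS : IsSupportHyperplane α δ α₀ η c) (hφ : ∀ i, Continuous (φ i))
    (hsurj : ∀ b : Fin k → ℝ, (∀ i, 0 < b i) → ∃ ξ : Rd d, ∀ i, ‖φ i ξ‖ = b i)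
    (hα : ∀ j i, 0 ≤ α j i) (hδ : ∀ j, 0 < δ j) :
    (⨆ (x : L2 d) (_ : x ∈ smoothSpace φ α) (_ : ∀ j, ‖multOp φ (α j) x‖ ≤ δ j),
      ‖multOp φ α₀ x‖ₑ) = ENNReal.ofReal (∏ j ∈ J, δ j ^ θ j) := by
  refine le_antisymm (iSup₂_le fun x hx => iSup_le fun hxδ => ?_) ?_
  · rw [← ofReal_norm]
    refine ENNReal.ofReal_le_ofReal ((h.norm_multOp_le hφ hα hx).trans ?_)
    exact Finset.prod_le_prod (fun j _ => Real.rpow_nonneg (norm_nonneg _) _) fun j hj =>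
      Real.rpow_le_rpow (norm_nonneg _) (hxδ j) (h.pos j hj).le
  · rw [h.prod_rpow hδ]
    exact ofReal_exp_le_iSup hφ hsurj id δ (hS.exp_le hδ)

theorem IsRepresentation.isExactInequality (h : IsRepresentation α δ α₀ η c J θ)
    (hφ : ∀ i, Continuous (φ i))
    (hsurj : ∀ b : Fin k → ℝ, (∀ i, 0 < b i) → ∃ ξ : Rd d, ∀ i, ‖φ i ξ‖ = b i)
    (hα : ∀ j i, 0 ≤ α j i) (hind : AffineIndependent ℝ (fun j : J => α j)) :
    IsExactInequality (smoothSpace φ α) (multOp φ α₀) (fun (j : J) => multOp φ (α j))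
      (fun t => ∏ j : J, t j ^ θ j) := by
  have hattach : ∀ x : L2 d, ∏ j : J, ‖multOp φ (α j) x‖ ^ θ j =
      ∏ j ∈ J, ‖multOp φ (α j) x‖ ^ θ j := fun x =>
    Finset.prod_coe_sort J fun j => ‖multOp φ (α j) x‖ ^ θ j
  refine ⟨fun x hx => (h.norm_multOp_le hφ hα hx).trans_eq (hattach x).symm, ?_⟩
  rintro ⟨x₀, -, hlt⟩
  simp only [hattach] at hlt
  refine absurd hlt (not_lt.2 ?_)
  by_cases hpos : ∀ j ∈ J, 0 < ‖multOp φ (α j) x₀‖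
  · have : Nonempty J := h.nonempty.to_subtype
    obtain ⟨η', c', hη'⟩ := exists_dotProduct_add_eq_of_affineIndependent hind fun j =>
      Real.log (1 / ‖multOp φ (α j) x₀‖)
    have hexp : ∀ j : J, Real.exp (-(α j ⬝ᵥ η' + c')) = ‖multOp φ (α j) x₀‖ := fun j => by
      rw [← hη' j, one_div, Real.log_inv, neg_neg, Real.exp_log (hpos j j.2)]
    have h' : IsRepresentation α (fun j => Real.exp (-(α j ⬝ᵥ η' + c'))) α₀ η' c' J θ :=
      { mem_hyperplane := fun j _ => by rw [one_div, Real.log_inv, Real.log_exp, neg_neg]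
        pos := h.pos
        sum_eq_one := h.sum_eq_one
        sum_eq := h.sum_eq }
    have hprod : ∏ j ∈ J, ‖multOp φ (α j) x₀‖ ^ θ j = Real.exp (-(α₀ ⬝ᵥ η' + c')) := by
      rw [← h'.prod_rpow fun j => Real.exp_pos _]
      exact Finset.prod_congr rfl fun j hj => by rw [hexp ⟨j, hj⟩]
    rw [hprod]
    exact ofReal_exp_le_iSup hφ hsurj (fun j : J => (j : Fin N))
      (fun j => ‖multOp φ (α j) x₀‖) fun j => (hexp j).le
  · push Not at hpos
    obtain ⟨j, hj, hj₀⟩ := hpos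
    rw [Finset.prod_eq_zero hj, ENNReal.ofReal_zero]
    · exact zero_le
    · rw [le_antisymm hj₀ (norm_nonneg _), Real.zero_rpow (h.pos j hj).ne']

/-! ### Optimal recovery -/

/-- The error of a method is not smaller than `‖Λ₀ x‖` for `x` compatible with zero data. -/
theorem enorm_le_methodError {X Y Z ι : Type*} [NormedAddCommGroup Y] [NormedAddCommGroup Z]
    [NormedSpace ℝ Z] {Λ₀ : X → Z} {W : Set X} {Λ : ι → X → Y} {δ : ι → ℝ} (Φ : (ι → Y) → Z) {x x' : X}
    (hx : x ∈ W) (hx' : x' ∈ W) (hδ : ∀ j, ‖Λ j x‖ ≤ δ j) (hδ' : ∀ j, ‖Λ j x'‖ ≤ δ j)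
    (hneg : Λ₀ x' = -Λ₀ x) : ‖Λ₀ x‖ₑ ≤ methodError Λ₀ W Λ δ Φ := by
  have h₁ : ‖Λ₀ x - Φ 0‖ₑ ≤ methodError Λ₀ W Λ δ Φ :=
    le_iSup₂_of_le x hx (le_iSup₂_of_le 0 (by simpa using hδ) le_rfl)
  have h₂ : ‖Λ₀ x' - Φ 0‖ₑ ≤ methodError Λ₀ W Λ δ Φ :=
    le_iSup₂_of_le x' hx' (le_iSup₂_of_le 0 (by simpa using hδ') le_rfl)
  have h₃ : 2 * ‖Λ₀ x‖ ≤ ‖Λ₀ x - Φ 0‖ + ‖Λ₀ x' - Φ 0‖ := by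
    refine le_trans (le_of_eq ?_) (norm_sub_le _ _)
    rw [sub_sub_sub_cancel_right, hneg, sub_neg_eq_add, ← two_smul ℝ, norm_smul, Real.norm_two]
  rcases le_total ‖Λ₀ x - Φ 0‖ ‖Λ₀ x' - Φ 0‖ with hle | hle
  · exact le_trans (enorm_le_iff_norm_le.2 (by linarith)) h₂
  · exact le_trans (enorm_le_iff_norm_le.2 (by linarith)) h₁

theorem IsSupportHyperplane.le_optimalError (hS : IsSupportHyperplane α δ α₀ η c)
    (h : IsRepresentation α δ α₀ η c J θ) (hmN : m ≤ N) (hφ : ∀ i, Continuous (φ i))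
    (hsurj : ∀ b : Fin k → ℝ, (∀ i, 0 < b i) → ∃ ξ : Rd d, ∀ i, ‖φ i ξ‖ = b i)
    (hα : ∀ j i, 0 ≤ α j i) (hδ : ∀ j, 0 < δ j) :
    ENNReal.ofReal (Real.exp (-(α₀ ⬝ᵥ η + c))) ≤
      optimalError (multOp φ α₀) (smoothClass m φ α δ)
        (fun j : Fin m => multOp φ (α (Fin.castLE hmN j))) (fun j => δ (Fin.castLE hmN j)) := by
  refine le_iInf fun Φ => ?_
  rw [← h.prod_rpow hδ, ← h.iSup_enorm_multOp hS hφ hsurj hα hδ]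
  refine iSup₂_le fun x hx => iSup_le fun hxδ => ?_
  have hneg : ∀ j, ‖multOp φ (α j) (-x)‖ ≤ δ j := fun j => by
    rw [multOp_neg _ _ (hx j), norm_neg]
    exact hxδ j
  exact enorm_le_methodError Φ ⟨hx, fun j _ => hxδ j⟩ ⟨neg_mem_smoothSpace hx, fun j _ => hneg j⟩
    (fun j => hxδ _) (fun j => hneg _) (multOp_neg _ _ (h.memLp hφ hα hx))

theorem IsRepresentation.exists_isAdmissible (h : IsRepresentation α δ α₀ η c J θ)
    (hφ : ∀ i, Continuous (φ i)) (hα : ∀ j i, 0 ≤ α j i) (hδ : ∀ j, 0 < δ j) :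
    ∃ a, IsAdmissible φ α δ α₀ J θ (α₀ ⬝ᵥ η + c) a := by
  let D : Rd d → ℝ := fun ξ => ∑ j ∈ J, θ j / δ j ^ 2 * ‖powSymbol φ (α j) ξ‖ ^ 2
  have hDm : Measurable D := Finset.measurable_sum _ fun j _ =>
    ((measurable_powSymbol hφ (α j)).norm.pow_const 2).const_mul _
  have hDnn : ∀ ξ, ∀ j ∈ J, 0 ≤ θ j / δ j ^ 2 * ‖powSymbol φ (α j) ξ‖ ^ 2 := fun ξ j hj => by
    have := h.pos j hj
    positivity
  -- the weighted inequality of the arithmetic and geometric means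
  have hAG : ∀ ξ, ‖powSymbol φ α₀ ξ‖ ^ 2 ≤ Real.exp (-2 * (α₀ ⬝ᵥ η + c)) * D ξ := fun ξ => by
    have h₁ := Real.geom_mean_le_arith_mean_weighted J θ (fun j => (‖powSymbol φ (α j) ξ‖ / δ j) ^ 2)
      (fun j hj => (h.pos j hj).le) h.sum_eq_one fun j _ => sq_nonneg _
    have h₂ : ∏ j ∈ J, ((‖powSymbol φ (α j) ξ‖ / δ j) ^ 2) ^ θ j =
        (‖powSymbol φ α₀ ξ‖ / Real.exp (-(α₀ ⬝ᵥ η + c))) ^ 2 := by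
      rw [h.norm_powSymbol hα, ← h.prod_rpow hδ, ← Finset.prod_div_distrib, ← Finset.prod_pow]
      refine Finset.prod_congr rfl fun j _ => ?_
      rw [← Real.div_rpow (norm_nonneg _) (hδ j).le,
        Real.rpow_pow_comm (div_nonneg (norm_nonneg _) (hδ j).le)]
    have h₃ : ∑ j ∈ J, θ j * (‖powSymbol φ (α j) ξ‖ / δ j) ^ 2 = D ξ :=
      Finset.sum_congr rfl fun j _ => by ring
    have h₄ : Real.exp (-2 * (α₀ ⬝ᵥ η + c)) = Real.exp (-(α₀ ⬝ᵥ η + c)) ^ 2 := by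
      rw [← Real.exp_nat_mul]
      congr 1
      push_cast
      ring
    rw [h₂, h₃, div_pow, div_le_iff₀ (by positivity)] at h₁
    rw [h₄]
    linarith
  have hzero : ∀ ξ, D ξ = 0 → powSymbol φ α₀ ξ = 0 := fun ξ hξ => by
    have := hAG ξ
    rw [hξ, mul_zero] at this
    exact norm_eq_zero.1 (pow_eq_zero_iff two_ne_zero |>.1 (le_antisymm this (sq_nonneg _)))
  refine ⟨fun j ξ => (θ j / δ j ^ 2 : ℝ) * starRingEnd ℂ (powSymbol φ (α j) ξ) *
    powSymbol φ α₀ ξ / (D ξ : ℝ), ⟨fun j _ => ?_, ?_, ?_⟩⟩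
  · have h₁ := measurable_powSymbol hφ (α j)
    have h₂ := measurable_powSymbol hφ α₀
    have h₃ : Measurable fun ξ => starRingEnd ℂ (powSymbol φ (α j) ξ) :=
      Complex.continuous_conj.measurable.comp h₁
    exact (((h₃.const_mul _).mul h₂).div (Complex.measurable_ofReal.comp hDm)).aestronglyMeasurable
  · refine Filter.Eventually.of_forall fun ξ => ?_
    by_cases hD : D ξ = 0
    · simp [hzero ξ hD]
    · have hD' : (D ξ : ℂ) ≠ 0 := by exact_mod_cast hD
      have h₁ : ∀ j, powSymbol φ (α j) ξ * ((θ j / δ j ^ 2 : ℝ) *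
          starRingEnd ℂ (powSymbol φ (α j) ξ) * powSymbol φ α₀ ξ / (D ξ : ℝ)) =
          ((θ j / δ j ^ 2 * ‖powSymbol φ (α j) ξ‖ ^ 2 : ℝ) : ℂ) *
            (powSymbol φ α₀ ξ / (D ξ : ℝ)) := fun j => by
        have := Complex.mul_conj' (powSymbol φ (α j) ξ)
        rw [Complex.ofReal_mul, Complex.ofReal_pow, ← this]
        ring
      rw [Finset.sum_congr rfl fun j _ => h₁ j, ← Finset.sum_mul, ← Complex.ofReal_sum]
      exact mul_div_cancel₀ _ hD'
  · refine Filter.Eventually.of_forall fun ξ => ?_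
    by_cases hD : D ξ = 0
    · simp [hD, Real.exp_nonneg]
    · have hDpos : 0 < D ξ := lt_of_le_of_ne (Finset.sum_nonneg (hDnn ξ)) (Ne.symm hD)
      have h₁ : ∀ j ∈ J, δ j ^ 2 * ‖((θ j / δ j ^ 2 : ℝ) *
          starRingEnd ℂ (powSymbol φ (α j) ξ) * powSymbol φ α₀ ξ / (D ξ : ℝ) : ℂ)‖ ^ 2 / θ j =
          (θ j / δ j ^ 2 * ‖powSymbol φ (α j) ξ‖ ^ 2) * (‖powSymbol φ α₀ ξ‖ ^ 2 / D ξ ^ 2) := by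
        intro j hj
        have hθ := h.pos j hj
        have hδj := hδ j
        rw [norm_div, norm_mul, norm_mul, Complex.norm_conj, Complex.norm_real, Complex.norm_real,
          Real.norm_of_nonneg (by positivity), Real.norm_of_nonneg hDpos.le]
        field_simp
      rw [Finset.sum_congr rfl h₁, ← Finset.sum_mul]
      change D ξ * _ ≤ _
      have h₂ : D ξ * (‖powSymbol φ α₀ ξ‖ ^ 2 / D ξ ^ 2) = ‖powSymbol φ α₀ ξ‖ ^ 2 / D ξ := by
        field_simp
      rw [h₂, div_le_iff₀ hDpos]
      exact hAG ξ

theorem sum_observed {M : Type*} [AddCommMonoid M] (hmN : m ≤ N) (J : Finset (Fin N))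
    (F : Fin m → M) :
    ∑ j ∈ observed hmN J, F j = ∑ j ∈ J, if hj : (j : ℕ) < m then F ⟨j, hj⟩ else 0 := by
  have h₁ := Finset.sum_map (observed hmN J) (Fin.castLEEmb hmN)
    fun j : Fin N => if hj : (j : ℕ) < m then F ⟨j, hj⟩ else 0
  simp only [Fin.castLEEmb_apply, Fin.val_castLE, Fin.is_lt, dif_pos] at h₁
  rw [← h₁]
  refine Finset.sum_subset (fun j hj => ?_) fun j hj hj' => dif_neg fun hjm => hj' ?_
  · obtain ⟨i, hi, rfl⟩ := Finset.mem_map.1 hj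
    exact (Finset.mem_filter.1 hi).2
  · exact Finset.mem_map.2 ⟨⟨j, hjm⟩, Finset.mem_filter.2 ⟨Finset.mem_univ _, hj⟩, rfl⟩

/-- The error of `y ↦ F⁻¹(∑_{j ∈ M} a_j F y_j)` does not exceed `e^{-s}`. -/
theorem IsAdmissible.memLp_and_methodError_le {s : ℝ} {a : Fin N → Rd d → ℂ}
    (ha : IsAdmissible φ α δ α₀ J θ s a) (h : IsRepresentation α δ α₀ η c J θ) (hmN : m ≤ N)
    (hφ : ∀ i, Continuous (φ i)) (hα : ∀ j i, 0 ≤ α j i) (hδ : ∀ j, 0 < δ j) :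
    (∀ y : Fin m → L2 d, MemLp (fun ξ => ∑ j ∈ observed hmN J,
      a (Fin.castLE hmN j) ξ * (𝓕 (y j) : L2 d) ξ) 2 (volume : Measure (Rd d))) ∧
    methodError (multOp φ α₀) (smoothClass m φ α δ)
      (fun j : Fin m => multOp φ (α (Fin.castLE hmN j))) (fun j => δ (Fin.castLE hmN j))
      (multMethod (observed hmN J) (fun j => a (Fin.castLE hmN j))) ≤
        ENNReal.ofReal (Real.exp (-s)) := by
  have hmem : ∀ y : Fin m → L2 d, MemLp (fun ξ => ∑ j ∈ observed hmN J,
      a (Fin.castLE hmN j) ξ * (𝓕 (y j) : L2 d) ξ) 2 (volume : Measure (Rd d)) := fun y => by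
    refine memLp_finsetSum _ fun j hj => ?_
    have hj' : Fin.castLE hmN j ∈ J := (Finset.mem_filter.1 hj).2
    set i := Fin.castLE hmN j
    refine (Lp.memLp (𝓕 (y j) : L2 d)).of_le_mul (c := √(θ i * Real.exp (-2 * s) / δ i ^ 2))
      ((ha.measurable i hj').mul (Lp.aestronglyMeasurable _)) ?_
    filter_upwards [ha.sum_le] with ξ hξ
    rw [norm_mul]
    refine mul_le_mul_of_nonneg_right (Real.le_sqrt_of_sq_le ?_) (norm_nonneg _)
    have h₁ := (Finset.single_le_sum (f := fun j => δ j ^ 2 * ‖a j ξ‖ ^ 2 / θ j) (fun j hj => by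
      have := h.pos j hj
      positivity) hj').trans hξ
    have hδi := hδ i
    rw [div_le_iff₀ (h.pos i hj')] at h₁
    rw [le_div_iff₀ (by positivity)]
    linarith
  refine ⟨hmem, iSup₂_le fun x hx => iSup₂_le fun y hy => ?_⟩
  rw [multOp, multMethod, invFourier_sub (h.memLp hφ hα hx.1) (hmem y)]
  refine (enorm_invFourier ((h.memLp hφ hα hx.1).sub (hmem y))).trans_le ?_
  let u : Fin N → Rd d → ℂ := fun j ξ => powSymbol φ (α j) ξ * (𝓕 x : L2 d) ξ -
    if hj : (j : ℕ) < m then (𝓕 (y ⟨j, hj⟩) : L2 d) ξ else 0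
  have hae : (fun ξ => powSymbol φ α₀ ξ * (𝓕 x : L2 d) ξ - ∑ j ∈ observed hmN J,
      a (Fin.castLE hmN j) ξ * (𝓕 (y j) : L2 d) ξ) =ᵐ[volume] fun ξ => ∑ j ∈ J, a j ξ * u j ξ := by
    filter_upwards [ha.sum_eq] with ξ hξ
    rw [← hξ, sum_observed, Finset.sum_mul, ← Finset.sum_sub_distrib]
    refine Finset.sum_congr rfl fun j _ => ?_
    by_cases hj : (j : ℕ) < m
    · have : Fin.castLE hmN ⟨j, hj⟩ = j := rfl
      simp only [u, hj, dif_pos, this]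
      ring
    · simp only [u, hj, dif_neg, not_false_eq_true]
      ring
  refine (eLpNorm_congr_ae hae).trans_le ?_
  refine eLpNorm_two_sum_mul_le J (Real.exp_nonneg _) (fun j _ => hδ j) h.pos h.sum_eq_one
    (fun j _ => ?_) ?_ fun j _ => ?_
  · refine (hx.1 j).1.sub ?_
    by_cases hj : (j : ℕ) < m
    · simp only [hj, dif_pos]
      exact Lp.aestronglyMeasurable _
    · simp only [hj, dif_neg, not_false_eq_true]
      exact aestronglyMeasurable_const
  · have : Real.exp (-s) ^ 2 = Real.exp (-2 * s) := by
      rw [← Real.exp_nat_mul]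
      congr 1
      push_cast
      ring
    rw [this]
    exact ha.sum_le
  · by_cases hj : (j : ℕ) < m
    · have h₁ : multOp φ (α j) x - y ⟨j, hj⟩ = invFourier (u j) := by
        have h₂ : y ⟨j, hj⟩ = invFourier (𝓕 (y ⟨j, hj⟩) : L2 d) := by
          rw [invFourier_of_memLp (Lp.memLp _), Lp.toLp_coeFn,
            FourierTransform.fourierInv_fourier_eq]
        conv_lhs => rw [h₂]
        rw [multOp, invFourier_sub (hx.1 j) (Lp.memLp _)]
        simp only [u, hj, dif_pos]
      have hu : MemLp (u j) 2 volume := by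
        simp only [u, hj, dif_pos]
        exact (hx.1 j).sub (Lp.memLp _)
      rw [← enorm_invFourier hu, ← h₁, ← ofReal_norm]
      exact ENNReal.ofReal_le_ofReal (hy ⟨j, hj⟩)
    · simp only [u, hj, dif_neg, not_false_eq_true, sub_zero]
      rw [← enorm_multOp (hx.1 j), ← ofReal_norm]
      exact ENNReal.ofReal_le_ofReal (hx.2 j (not_lt.1 hj))

theorem IsRepresentation.optimalError_eq (h : IsRepresentation α δ α₀ η c J θ)
    (hS : IsSupportHyperplane α δ α₀ η c) (hmN : m ≤ N) (hφ : ∀ i, Continuous (φ i))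
    (hsurj : ∀ b : Fin k → ℝ, (∀ i, 0 < b i) → ∃ ξ : Rd d, ∀ i, ‖φ i ξ‖ = b i)
    (hα : ∀ j i, 0 ≤ α j i) (hδ : ∀ j, 0 < δ j) :
    optimalError (multOp φ α₀) (smoothClass m φ α δ)
        (fun j : Fin m => multOp φ (α (Fin.castLE hmN j))) (fun j => δ (Fin.castLE hmN j)) =
      ENNReal.ofReal (Real.exp (-(α₀ ⬝ᵥ η + c))) := by
  obtain ⟨a, ha⟩ := h.exists_isAdmissible hφ hα hδ
  exact le_antisymm ((iInf_le _ _).trans (ha.memLp_and_methodError_le h hmN hφ hα hδ).2)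
    (hS.le_optimalError h hmN hφ hsurj hα hδ)

theorem IsAdmissible.isOptimalMethod {a : Fin N → Rd d → ℂ}
    (ha : IsAdmissible φ α δ α₀ J θ (α₀ ⬝ᵥ η + c) a) (h : IsRepresentation α δ α₀ η c J θ)
    (hS : IsSupportHyperplane α δ α₀ η c) (hmN : m ≤ N) (hφ : ∀ i, Continuous (φ i))
    (hsurj : ∀ b : Fin k → ℝ, (∀ i, 0 < b i) → ∃ ξ : Rd d, ∀ i, ‖φ i ξ‖ = b i)
    (hα : ∀ j i, 0 ≤ α j i) (hδ : ∀ j, 0 < δ j) :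
    IsOptimalMethod (multOp φ α₀) (smoothClass m φ α δ)
      (fun j : Fin m => multOp φ (α (Fin.castLE hmN j))) (fun j => δ (Fin.castLE hmN j))
      (multMethod (observed hmN J) (fun j => a (Fin.castLE hmN j))) :=
  le_antisymm (((ha.memLp_and_methodError_le h hmN hφ hα hδ).2).trans_eq
    (h.optimalError_eq hS hmN hφ hsurj hα hδ).symm) (iInf_le _ _)

end Main

end OptimalRecovery

open OptimalRecovery MeasureTheory in
theorem theorem2 {d k N m : ℕ} (hm : 1 ≤ m) (hmN : m ≤ N)
    (φ : Fin k → Rd d → ℂ) (hφ : ∀ i, Continuous (φ i))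
    (hsurj : ∀ b : Fin k → ℝ, (∀ i, 0 < b i) → ∃ ξ : Rd d, ∀ i, ‖φ i ξ‖ = b i)
    (α : Fin N → Fin k → ℝ) (hα : ∀ j i, 0 ≤ α j i)
    (δ : Fin N → ℝ) (hδ : ∀ j, 0 < δ j)
    (α₀ : Fin k → ℝ) (hα₀ : α₀ ∈ convexHull ℝ (Set.range α)) :
    -- the maximum that defines `S(α₀)` is attained
    IsGreatest {z : ℝ | (α₀, z) ∈ hullQ α δ} (funS α δ α₀).toReal ∧
    -- `Λ₀` maps the space into `L₂`
    (∀ x ∈ smoothSpace φ α,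
      MemLp (fun ξ => powSymbol φ α₀ ξ * (FourierTransform.fourier x : L2 d) ξ) 2
        (volume : Measure (Rd d))) ∧
    -- the error of optimal recovery
    optimalError (multOp φ α₀) (smoothClass m φ α δ)
        (fun j : Fin m => multOp φ (α (Fin.castLE hmN j))) (fun j => δ (Fin.castLE hmN j)) =
      ENNReal.ofReal (Real.exp (-(funS α δ α₀).toReal)) ∧
    -- support hyperplanes at `α₀` and representations exist
    (∃ η c, IsSupportHyperplane α δ α₀ η c) ∧
    ∀ η c, IsSupportHyperplane α δ α₀ η c →
      (∃ J θ, IsRepresentation α δ α₀ η c J θ ∧ J.card ≤ k + 1 ∧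
        AffineIndependent ℝ (fun j : J => α j)) ∧
      ∀ J θ, IsRepresentation α δ α₀ η c J θ →
        -- optimal methods
        (∃ a, IsAdmissible φ α δ α₀ J θ (funS α δ α₀).toReal a) ∧
        ((observed hmN J).Nonempty →
          ∀ a, IsAdmissible φ α δ α₀ J θ (funS α δ α₀).toReal a →
            (∀ y : Fin m → L2 d,
              MemLp (fun ξ => ∑ j ∈ observed hmN J,
                a (Fin.castLE hmN j) ξ * (FourierTransform.fourier (y j) : L2 d) ξ) 2
                (volume : Measure (Rd d))) ∧
            IsOptimalMethod (multOp φ α₀) (smoothClass m φ α δ)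
              (fun j : Fin m => multOp φ (α (Fin.castLE hmN j))) (fun j => δ (Fin.castLE hmN j))
              (multMethod (observed hmN J) (fun j => a (Fin.castLE hmN j)))) ∧
        (observed hmN J = ∅ →
          IsOptimalMethod (multOp φ α₀) (smoothClass m φ α δ)
            (fun j : Fin m => multOp φ (α (Fin.castLE hmN j))) (fun j => δ (Fin.castLE hmN j))
            (fun _ => 0)) ∧
        -- the inequality, and that its constant `1` is best possible
        (∀ x ∈ smoothSpace φ α,
          ‖multOp φ α₀ x‖ ≤ ∏ j ∈ J, ‖multOp φ (α j) x‖ ^ θ j) ∧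
        (∀ C : ℝ, (∀ x ∈ smoothSpace φ α,
          ‖multOp φ α₀ x‖ ≤ C * ∏ j ∈ J, ‖multOp φ (α j) x‖ ^ θ j) → 1 ≤ C) ∧
        -- the inequality is sharp for the given bounds `δ`, all `N` operators taken into account
        (⨆ (x : L2 d) (_ : x ∈ smoothSpace φ α) (_ : ∀ j, ‖multOp φ (α j) x‖ ≤ δ j),
            ‖multOp φ α₀ x‖ₑ) = ENNReal.ofReal (∏ j ∈ J, δ j ^ θ j) ∧
        -- it is exact as an inequality between `Λ₀` and the operators that occur in it
        (AffineIndependent ℝ (fun j : J => α j) →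
          IsExactInequality (smoothSpace φ α) (multOp φ α₀)
            (fun (j : J) => multOp φ (α j)) (fun t => ∏ j : J, t j ^ θ j)) := by
  obtain ⟨η₁, c₁, hS₁⟩ := exists_isSupportHyperplane (δ := δ) hα₀
  obtain ⟨J₁, θ₁, hR₁, -⟩ := hS₁.exists_isRepresentation hα₀
  refine ⟨(isGreatest_toReal_funS hα₀).1, fun x hx => hR₁.memLp hφ hα hx, ?_, ⟨η₁, c₁, hS₁⟩,
    fun η c hS => ⟨hS.exists_isRepresentation hα₀, fun J θ hR => ?_⟩⟩
  · rw [hS₁.toReal_funS]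
    exact hR₁.optimalError_eq hS₁ hmN hφ hsurj hα hδ
  · rw [hS.toReal_funS]
    have hadm := hR.exists_isAdmissible hφ hα hδ
    refine ⟨hadm, fun _ a ha => ⟨(ha.memLp_and_methodError_le hR hmN hφ hα hδ).1,
      ha.isOptimalMethod hR hS hmN hφ hsurj hα hδ⟩, fun hM => ?_,
      fun x hx => hR.norm_multOp_le hφ hα hx,
      fun C hC => hR.one_le_of_forall_norm_le hφ hsurj hC,
      hR.iSup_enorm_multOp hS hφ hsurj hα hδ, hR.isExactInequality hφ hsurj hα⟩
    obtain ⟨a, ha⟩ := hadm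
    have hzero : multMethod (observed hmN J) (fun j => a (Fin.castLE hmN j)) = fun _ => 0 := by
      funext y
      simp only [multMethod, hM, Finset.sum_empty]
      exact invFourier_zero
    rw [← hzero]
    exact ha.isOptimalMethod hR hS hmN hφ hsurj hα hδ
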